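/- Let $n\ge 2$ be an integer and let $0<d<1$ be a real number. For an integer $L\ge 1$ let $R_L$ be the set of elements of the free group on $s_1,\dots,s_n$ that are represented by reduced words of length exactly $L$ in the letters $s_1^{\pm1},\dots,s_n^{\pm1}$ (the words need not be cyclically reduced). Choose uniformly at random a $\lfloor(2n-1)^{dL}\rfloor$-tuple $R$ of elements of $R_L$, that is, choose its entries independently and uniformly, repetitions allowed, and let $G=\langle s_1,\dots,s_n\mid R\rangle$ be the group presented by it. Then $$\Pr\bigl(G \text{ has property (FA)}\bigr)\longrightarrow 1\qquad\text{as } L\to\infty ,$$ where a group $G$ has property (FA) if every action of $G$ by simplicial automorphisms on a simplicial tree $T$ has a global fixed point in the geometric realization of $T$, i.e. $G$ fixes a vertex of $T$ or preserves an edge of $T$ (and hence fixes its midpoint). In particular, for an action without inversions of edges, $G$ fixes a vertex. -/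

import Mathlib

universe u v

/-- The set `R_L` of elements of the free group on `n` generators that are represented by
a reduced word of length exactly `L`
(not necessarily cyclically reduced). -/
def reducedWords (n L : ℕ) : Set (FreeGroup (Fin n)) :=
  {w | w.toWord.length = L}

/-- There are only finitely many reduced words of a given length, so the uniform distribution
on tuples of them makes sense. -/
instance reducedWords_finite (n L : ℕ) : Finite (reducedWords n L) := by
  have h : Finite {l : List (Fin n × Bool) // l.length = L} :=
    (List.finite_length_eq (Fin n × Bool) L).to_subtype
  exact Finite.of_injective
    (fun w : reducedWords n L =>
      (⟨w.1.toWord, w.2⟩ : {l : List (Fin n × Bool) // l.length = L}))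
    (fun a b hab => Subtype.ext (FreeGroup.toWord_injective (congrArg Subtype.val hab)))

/-- The number `⌊(2n-1)^{dL}⌋` of relators at density `d` and length `L`. -/
noncomputable def numRelators (n : ℕ) (d : ℝ) (L : ℕ) : ℕ :=
  ⌊(2 * (n : ℝ) - 1) ^ (d * (L : ℝ))⌋₊

/-- The sample space of the density model: all `⌊(2n-1)^{dL}⌋`-tuples of elements of `R_L`
(repetitions allowed). -/
abbrev RelatorTuple (n : ℕ) (d : ℝ) (L : ℕ) : Type :=
  Fin (numRelators n d L) → reducedWords n L

/-- The group `⟨s_1, …, s_n | R⟩` presented by a tuple `R` of relators. -/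
abbrev groupOfRelators {n : ℕ} {d : ℝ} {L : ℕ} (R : RelatorTuple n d L) : Type :=
  PresentedGroup (Set.range fun i => (R i : FreeGroup (Fin n)))

/-- The probability that a property `P` holds for a uniformly random tuple of relators at
density `d` and length `L`. The uniform distribution on tuples is the law of independent,
uniformly distributed elements of `R_L`. -/
noncomputable def relatorProb (n : ℕ) (d : ℝ) (L : ℕ) (P : RelatorTuple n d L → Prop) : ℝ :=
  (Nat.card {R : RelatorTuple n d L // P R} : ℝ) / (Nat.card (RelatorTuple n d L) : ℝ)

/-- `P` occurs with overwhelming probability at density `d` (on `n` generators): its probability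
tends to `1` as the length `L` of the relators tends to infinity. -/
def WithOverwhelmingProbability (n : ℕ) (d : ℝ)
    (P : ∀ L : ℕ, RelatorTuple n d L → Prop) : Prop :=
  Filter.Tendsto (fun L : ℕ => relatorProb n d L (P L)) Filter.atTop (nhds 1)

/-- Property (FA): every action of `G` by automorphisms on a simplicial tree has a global fixed
point. Inversions of edges are allowed, and a point is a point of the geometric realization:
a simplicial action fixes one if and only if it fixes a vertex or preserves an edge (it then
fixes the midpoint of this edge). For actions without inversions this says that there is a global
fixed vertex, since the endpoints of a preserved edge are then fixed. -/
def HasPropertyFA (G : Type v) [Group G] : Prop :=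
  ∀ (V : Type u) (T : SimpleGraph V), T.IsTree → ∀ ρ : G →* (T ≃g T),
    (∃ x : V, ∀ g : G, ρ g x = x) ∨
      (∃ x y : V, T.Adj x y ∧ ∀ g : G, s(ρ g x, ρ g y) = s(x, y))

/-! If $G$ fails (FA), the free group acts on a tree through $G$ with neither a fixed vertex nor a
preserved edge. By `IsTreeDist.exists_onAxis`, a variant of a lemma of Serre, some $c = s_i s_j$ is
then hyperbolic. By `IsTreeDist.exists_turns`, a fixed proportion of the words in any finite
symmetric family can be interlaced with $c^{\pm1}$ without backtracking in the tree. For every $l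
\ge 1$ this yields a prefix $p$ and a set $B$ of words of length $b = 2l+12$ such that each product
$p\,b_1\cdots b_k$ with $k\ge 1$ is reduced and acts nontrivially (`IsTreeDist.exists_blocks`).
Hence no relator lies in this language.

The loss per block is bounded independently of $l$: the language makes up at least a proportion
$1/(C K^k)$ of the words of length $L$, where $K = 256(2n)^{12}$ and $k = \lfloor (L-2)/b\rfloor$.
Once $b$ is so large that $(2n-1)^{db} \ge 2K$, the number of relators exceeds $C K^k$ by a factor
tending to infinity. A random tuple therefore avoids a given language with probability tending to
$0$. Infinitely many actions are possible, but the pair $(p, B)$ takes only a number of values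
bounded in terms of $n$ and $b$. As $b$ stays fixed when $L \to \infty$, a union bound finishes the
proof. -/

/-! ### Metric properties of trees. -/

/-- A discrete metric that behaves like the vertex metric of a tree: it satisfies the four-point
condition, is geodesic, and adjacent points are never equidistant from a third one. -/
structure IsTreeDist {V : Type*} (d : V → V → ℕ) : Prop where
  eq_zero : ∀ x y, d x y = 0 ↔ x = y
  comm : ∀ x y, d x y = d y x
  triangle : ∀ x y z, d x z ≤ d x y + d y z
  four_point : ∀ a b c e, d a b + d c e ≤ max (d a c + d b e) (d a e + d b c)
  step : ∀ x y, x ≠ y → ∃ z, d x z = 1 ∧ d z y + 1 = d x y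
  ne_of_adj : ∀ x z y, d x z = 1 → d x y ≠ d z y

namespace SimpleGraph.IsTree

variable {V : Type*} {T : SimpleGraph V}

/-- Appending the last edge to geodesics ending at `p` and `q` gives two paths from `a` to `v`;
paths in a tree are unique. -/
lemma eq_of_adj_of_dist_add_one (hT : T.IsTree) {a v p q : V} (hp : T.Adj p v) (hq : T.Adj q v)
    (hpd : T.dist a p + 1 = T.dist a v) (hqd : T.dist a q + 1 = T.dist a v) : p = q := by
  obtain ⟨w, -, hwl⟩ := hT.connected.exists_path_of_dist a p
  obtain ⟨w', -, hwl'⟩ := hT.connected.exists_path_of_dist a q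
  have h1 : (w.concat hp).IsPath := Walk.isPath_of_length_eq_dist _ (by
    rw [Walk.length_concat, hwl, hpd])
  have h2 : (w'.concat hq).IsPath := Walk.isPath_of_length_eq_dist _ (by
    rw [Walk.length_concat, hwl', hqd])
  have h3 : w.concat hp = w'.concat hq :=
    congrArg Subtype.val
      ((hT.isAcyclic.subsingleton_path a v).elim (⟨_, h1⟩ : T.Path a v) ⟨_, h2⟩)
  have h4 := congrArg Walk.penultimate h3
  simpa using h4

lemma exists_adj_dist_add_one (hT : T.IsTree) {x y : V} (h : x ≠ y) :
    ∃ z, T.Adj x z ∧ T.dist z y + 1 = T.dist x y := by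
  obtain ⟨w, hw⟩ := hT.connected.exists_walk_length_eq_dist x y
  cases w with
  | nil => exact absurd rfl h
  | cons hadj w' =>
    refine ⟨_, hadj, ?_⟩
    have h1 := dist_le w'
    have h2 := hadj.diff_dist_adj (u := y)
    rw [Walk.length_cons] at hw
    rw [dist_comm (u := y), dist_comm (u := y)] at h2
    omega

/-- A geodesic towards `e` that has started to move away from `a` never turns back: by uniqueness of
the predecessor it would have to return to `c`. -/
lemma dist_eq_add_of_adj (hT : T.IsTree) (a e : V) : ∀ (k : ℕ) (c c' : V), T.Adj c c' →
    T.dist a c' = T.dist a c + 1 → T.dist c' e = k → T.dist c e = k + 1 →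
    T.dist a e = T.dist a c + (k + 1) := by
  intro k
  induction k with
  | zero =>
    intro c c' _ h1 h2 _
    rw [hT.connected.dist_eq_zero_iff] at h2
    subst h2; omega
  | succ k ih =>
    intro c c' hadj h1 h2 h3
    have hne : c' ≠ e := by
      rintro rfl
      simp at h2
    obtain ⟨c'', hadj', h4⟩ := hT.exists_adj_dist_add_one hne
    have h5 := hT.dist_eq_dist_add_one_of_adj a hadj'
    rcases h5 with h5 | h5
    · have : c = c'' := hT.eq_of_adj_of_dist_add_one (a := a) hadj hadj'.symm (by omega) (by omega)
      subst this; omega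
    · have := ih c' c'' hadj' (by omega) (by omega) (by omega)
      omega

lemma four_point (hT : T.IsTree) (a b : V) : ∀ (k : ℕ) (c e : V), T.dist c e = k →
    T.dist a b + T.dist c e ≤ max (T.dist a c + T.dist b e) (T.dist a e + T.dist b c) := by
  intro k
  induction k with
  | zero =>
    intro c e h
    have h' := h
    rw [hT.connected.dist_eq_zero_iff] at h'
    subst h'
    have := hT.connected.dist_triangle (u := a) (v := c) (w := b)
    rw [dist_comm (u := c)] at this
    simp; omega
  | succ k ih =>
    intro c e h
    have hne : c ≠ e := by
      rintro rfl
      simp at h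
    obtain ⟨c', hadj, h1⟩ := hT.exists_adj_dist_add_one hne
    have h2 := ih c' e (by omega)
    have ha := hT.dist_eq_dist_add_one_of_adj a hadj
    have hb := hT.dist_eq_dist_add_one_of_adj b hadj
    have tri : ∀ x y z, T.dist x z ≤ T.dist x y + T.dist y z :=
      fun x y z => hT.connected.dist_triangle
    have t1 := tri a c b
    have t2 := tri b c a
    rw [dist_comm (u := c)] at t1 t2
    rw [dist_comm (u := b) (v := a)] at t2
    -- If `c'` is closer to both `a` and `b`, induction suffices. Otherwise `c` lies between `e` and
    -- one of them, and the triangle inequality suffices.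
    rcases ha with ha | ha
    · rcases hb with hb | hb
      · omega
      · have := hT.dist_eq_add_of_adj b e k c c' hadj hb (by omega) h
        omega
    · have := hT.dist_eq_add_of_adj a e k c c' hadj ha (by omega) h
      omega

lemma isTreeDist (hT : T.IsTree) : IsTreeDist T.dist where
  eq_zero _ _ := hT.connected.dist_eq_zero_iff
  comm _ _ := dist_comm
  triangle _ _ _ := hT.connected.dist_triangle
  four_point a b c e := hT.four_point a b _ c e rfl
  step x y h := by
    obtain ⟨z, hz, h'⟩ := hT.exists_adj_dist_add_one h
    exact ⟨z, dist_eq_one_iff_adj.2 hz, h'⟩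
  ne_of_adj x z y h := by
    have := hT.dist_ne_of_adj y (dist_eq_one_iff_adj.1 h)
    rwa [dist_comm, dist_comm (u := y)] at this

end SimpleGraph.IsTree

/-! ### Geodesics and directions at a vertex. -/

namespace IsTreeDist

variable {V : Type*} {d : V → V → ℕ}

lemma self (hd : IsTreeDist d) (x : V) : d x x = 0 := (hd.eq_zero x x).2 rfl

lemma pos (hd : IsTreeDist d) {x y : V} (h : x ≠ y) : 0 < d x y :=
  Nat.pos_of_ne_zero fun h0 => h ((hd.eq_zero x y).1 h0)

/-- Two geodesics that overlap in a nondegenerate segment concatenate to a geodesic. -/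
lemma concat (hd : IsTreeDist d) {a b c e : V} (h1 : d a c = d a b + d b c)
    (h2 : d b e = d b c + d c e) (hbc : 0 < d b c) : d a e = d a b + d b c + d c e := by
  have h3 := hd.four_point a c b e
  have h4 := hd.triangle a b e
  have h5 := hd.comm b c
  omega

/-- If `p` is the first vertex on the way from `v` to `e`, but not on the way from `v` to `a`,
then `v` lies between `a` and `e`. -/
lemma between (hd : IsTreeDist d) {a v p e : V} (hp : d v p = 1) (h1 : d p a ≠ d v a - 1)
    (h2 : d p e + 1 = d v e) : d a e = d a v + d v e := by
  have h3 := hd.ne_of_adj v p a hp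
  have h4 := hd.triangle p v a
  have h5 := hd.triangle v p a
  have h6 := hd.comm p v
  have h7 := hd.comm p a
  have h8 := hd.comm v a
  have := hd.concat (a := a) (b := v) (c := p) (e := e) (by omega) (by omega) (by omega)
  omega

lemma adj_dist (hd : IsTreeDist d) {v p : V} (hp : d v p = 1) (a : V) :
    d p a + 1 = d v a ∨ d p a = d v a + 1 := by
  have h3 := hd.ne_of_adj v p a hp
  have h4 := hd.triangle p v a
  have h5 := hd.triangle v p a
  have h6 := hd.comm p v
  omega

/-- The first vertex on the way from `v` to `y` is unique. -/
lemma step_unique (hd : IsTreeDist d) {v p q y : V} (hp : d v p = 1) (hq : d v q = 1)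
    (hpy : d p y + 1 = d v y) (hqy : d q y + 1 = d v y) : p = q := by
  have h1 := hd.four_point p q v y
  have h2 := hd.comm p v
  have h3 := hd.comm q v
  exact (hd.eq_zero p q).1 (by omega)

variable {G : Type*} [Group G] [MulAction G V]

lemma dist_inv_smul (hG : ∀ (g : G) x y, d (g • x) (g • y) = d x y) (g : G) (x y : V) :
    d (g⁻¹ • x) y = d x (g • y) := by
  rw [← hG g, smul_inv_smul]

lemma dist_inv_smul_self (hd : IsTreeDist d) (hG : ∀ (g : G) x y, d (g • x) (g • y) = d x y)
    (g : G) (x : V) : d x (g⁻¹ • x) = d x (g • x) := by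
  rw [hd.comm, dist_inv_smul hG]

end IsTreeDist

/-! ### Hyperbolic elements and their axes. -/

/-- The element `c` translates by `m > 0` along an axis through `v`. -/
def OnAxis {V G : Type*} [Group G] [MulAction G V] (d : V → V → ℕ) (c : G) (m : ℕ) (v : V) :
    Prop :=
  0 < m ∧ d v (c • v) = m ∧ d v (c • c • v) = 2 * m

namespace OnAxis

variable {V : Type*} {d : V → V → ℕ} {G : Type*} [Group G] [MulAction G V]

lemma inv (hd : IsTreeDist d) (hG : ∀ (g : G) x y, d (g • x) (g • y) = d x y) {c : G} {m : ℕ}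
    {v : V} (h : OnAxis d c m v) : OnAxis d c⁻¹ m v := by
  obtain ⟨h0, h1, h2⟩ := h
  refine ⟨h0, ?_, ?_⟩
  · rw [hd.comm, IsTreeDist.dist_inv_smul hG, h1]
  · rw [hd.comm, IsTreeDist.dist_inv_smul hG, IsTreeDist.dist_inv_smul hG, h2]

lemma of_between (hd : IsTreeDist d) (hG : ∀ (g : G) x y, d (g • x) (g • y) = d x y) {c : G}
    {v : V} (h0 : c • v ≠ v) (h : d (c⁻¹ • v) (c • v) = d (c⁻¹ • v) v + d v (c • v)) :
    OnAxis d c (d v (c • v)) v := by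
  refine ⟨hd.pos h0.symm, rfl, ?_⟩
  rw [IsTreeDist.dist_inv_smul hG, IsTreeDist.dist_inv_smul hG] at h
  omega

lemma dist_inv_smul (hG : ∀ (g : G) x y, d (g • x) (g • y) = d x y) {c : G} {m : ℕ}
    {v : V} (h : OnAxis d c m v) : d (c⁻¹ • v) (c • v) = 2 * m := by
  rw [IsTreeDist.dist_inv_smul hG]; exact h.2.2

lemma dist_three (hd : IsTreeDist d) (hG : ∀ (g : G) x y, d (g • x) (g • y) = d x y) {c : G}
    {m : ℕ} {v : V} (h : OnAxis d c m v) : d v (c • c • c • v) = 3 * m := by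
  obtain ⟨h0, h1, h2⟩ := h
  have h3 := hG c v (c • v)
  have h4 := hG c v (c • c • v)
  have h5 := hG c (c • v) (c • c • v)
  have := hd.concat (a := v) (b := c • v) (c := c • c • v) (e := c • c • c • v)
    (by omega) (by omega) (by omega)
  omega

/-- This lets a hyperbolic generator count as a hyperbolic product of two generators, so that the
hyperbolic word always has length 2. -/
lemma sq (hd : IsTreeDist d) (hG : ∀ (g : G) x y, d (g • x) (g • y) = d x y) {c : G}
    {m : ℕ} {v : V} (h : OnAxis d c m v) : OnAxis d (c * c) (2 * m) v := by
  have h3 := h.dist_three hd hG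
  obtain ⟨h0, h1, h2⟩ := h
  have h4 := hG c v (c • c • c • v)
  have h5 := hG c (c • v) (c • c • v)
  have h6 := hG c v (c • v)
  have h7 := hG c (c • c • v) (c • c • c • v)
  have h8 := hG c v (c • c • v)
  have := hd.concat (a := v) (b := c • v) (c := c • c • c • v) (e := c • c • c • c • v)
    (by omega) (by omega) (by omega)
  refine ⟨by omega, by rw [mul_smul]; omega, ?_⟩
  rw [mul_smul, mul_smul, this]
  omega

/-- The vertices next to `v` on the way to `c • v` lie on the axis, too. -/
lemma of_step (hd : IsTreeDist d) (hG : ∀ (g : G) x y, d (g • x) (g • y) = d x y) {c : G}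
    {m : ℕ} {v p : V} (h : OnAxis d c m v) (hp : d v p = 1) (hpc : d p (c • v) + 1 = m) :
    OnAxis d c m p := by
  have h3 := h.dist_three hd hG
  obtain ⟨h0, h1, h2⟩ := h
  have e1 := hG c v p
  have e2 := hG c p (c • v)
  have e3 := hG c (c • v) (c • p)
  have e4 := hG c (c • p) (c • c • v)
  have t1 := hd.triangle v p (c • c • v)
  have t2 := hd.triangle p (c • p) (c • c • v)
  have t3 := hd.triangle p (c • v) (c • p)
  have t4 := hd.triangle v p (c • c • c • v)
  have t5 := hd.triangle p (c • c • p) (c • c • c • v)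
  have t6 := hd.triangle p (c • p) (c • c • p)
  have e5 := hG c p (c • p)
  have e6 := hG c (c • p) (c • c • v)
  have := hd.triangle v (c • v) (c • c • v)
  exact ⟨h0, by omega, by omega⟩

end OnAxis

/-! ### A hyperbolic product of two generators. -/

open IsTreeDist in
/-- Given isometries `s i` of a tree, either they fix a common vertex, or they preserve a common
edge, or a product of two of them is hyperbolic. -/
theorem IsTreeDist.exists_onAxis {V : Type*} {d : V → V → ℕ} {G : Type*} [Group G] [MulAction G V]
    [Nonempty V] (hd : IsTreeDist d) (hG : ∀ (g : G) x y, d (g • x) (g • y) = d x y)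
    {ι : Type*} [Fintype ι] (s : ι → G) :
    (∃ v : V, ∀ i, s i • v = v) ∨
    (∃ v p : V, d v p = 1 ∧ ∀ i, (s i • v = v ∧ s i • p = p) ∨ (s i • v = p ∧ s i • p = v)) ∨
    ∃ (i j : ι) (m : ℕ) (v : V), OnAxis d (s i * s j) m v := by
  by_cases hyp : ∃ (i j : ι) (m : ℕ) (v : V), OnAxis d (s i * s j) m v
  · exact Or.inr (Or.inr hyp)
  push Not at hyp
  -- A vertex of minimal total displacement exists because displacements are natural numbers.
  obtain ⟨v, hv⟩ : ∃ v : V, ∀ w : V, ∑ i, d v (s i • v) ≤ ∑ i, d w (s i • w) := by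
    obtain ⟨v, -, hv⟩ := (measure fun v : V => ∑ i, d v (s i • v)).wf.has_min Set.univ
      Set.univ_nonempty
    exact ⟨v, fun w => not_lt.1 (hv w (Set.mem_univ w))⟩
  by_cases hfix : ∀ i, s i • v = v
  · exact Or.inl ⟨v, hfix⟩
  right; left
  push Not at hfix
  obtain ⟨i, hi⟩ := hfix
  obtain ⟨p, hp, hpi⟩ := hd.step v (s i • v) hi.symm
  have nohyp : ∀ j v, s j • v ≠ v →
      d ((s j)⁻¹ • v) (s j • v) ≠ d ((s j)⁻¹ • v) v + d v (s j • v) := fun j v hj h =>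
    hyp j j _ v ((OnAxis.of_between hd hG hj h).sq hd hG)
  -- If `s j` and its inverse moved `v` in different directions, `v` would lie on an axis of `s j`.
  have same : ∀ j q, s j • v ≠ v → d v q = 1 → d q (s j • v) + 1 = d v (s j • v) →
      d q ((s j)⁻¹ • v) + 1 = d v (s j • v) := by
    intro j q hj hq hqj
    by_contra hcon
    refine nohyp j v hj (hd.between hq ?_ hqj)
    have := hd.dist_inv_smul_self hG (s j) v
    have := hd.pos hj.symm
    omega
  have hpi' := same i p hi hp hpi
  have claim : ∀ j, (s j • v = v ∧ s j • p = p) ∨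
      (d p (s j • v) + 1 = d v (s j • v) ∧ d p ((s j)⁻¹ • v) + 1 = d v (s j • v)) := by
    intro j
    have ii := hd.dist_inv_smul_self hG (s i) v
    have cij : (s i * s j) • v = s i • s j • v := mul_smul _ _ _
    have cij' : (s i * s j)⁻¹ • v = (s j)⁻¹ • (s i)⁻¹ • v := by rw [mul_inv_rev, mul_smul]
    have iso1 := dist_inv_smul hG (s j) ((s i)⁻¹ • v) v
    by_cases hj : s j • v = v
    · left
      refine ⟨hj, ?_⟩
      -- If `s j` moves the direction `p` at `v`, the product `s i * s j` sends `v` towards `p` and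
      -- its inverse sends `v` elsewhere, so the product is hyperbolic.
      by_contra hjp
      have hj' : (s j)⁻¹ • v = v := by rw [inv_smul_eq_iff, hj]
      refine hyp i j _ v (OnAxis.of_between hd hG (by rw [cij, hj]; exact hi) ?_)
      rw [cij, cij', hj]
      refine hd.between hp ?_ hpi
      intro hcon
      apply hjp
      have e1 := hG (s j) v p
      have e2 := hG (s j) v ((s j)⁻¹ • (s i)⁻¹ • v)
      have e3 := hG (s j) p ((s j)⁻¹ • (s i)⁻¹ • v)
      rw [smul_inv_smul] at e2 e3
      rw [hj] at e1 e2
      have := hd.pos hi.symm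
      exact hd.step_unique (by omega) hp (y := (s i)⁻¹ • v) (by omega) (by omega)
    · right
      have jj := hd.dist_inv_smul_self hG (s j) v
      have hposi := hd.pos hi.symm
      have hposj := hd.pos (Ne.symm hj)
      suffices h : d p (s j • v) + 1 = d v (s j • v) from ⟨h, same j p hj hp h⟩
      by_contra hcon
      have hcon' : d p ((s j)⁻¹ • v) + 1 ≠ d v (s j • v) := by
        intro h
        apply nohyp j v hj
        rw [hd.comm, hd.comm _ v, hd.comm v (s j • v), add_comm]
        exact hd.between hp (by omega) (by omega)
      -- As `s i` and its inverse move `v` towards `p`, but `s j` and its inverse do not, the images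
      -- of `v` under $(s_i s_j)^{-1}$, $s_j^{-1}$, $1$, $s_i$, $s_i s_j$ lie in this order on a
      -- geodesic.
      have a1 : d ((s i)⁻¹ • v) (s j • v) = d v (s i • v) + d v (s j • v) := by
        have := hd.between (a := s j • v) (e := (s i)⁻¹ • v) hp (by omega) (by omega)
        rw [hd.comm, this, hd.comm (s j • v), ii, add_comm]
      have a2 : d ((s j)⁻¹ • v) (s i • v) = d v (s j • v) + d v (s i • v) := by
        have := hd.between (a := (s j)⁻¹ • v) (e := s i • v) hp (by omega) (by omega)
        rw [this, hd.comm ((s j)⁻¹ • v), jj]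
      have a3 : d v (s i • s j • v) = d v (s i • v) + d v (s j • v) := by
        rw [← a1, dist_inv_smul hG]
      have a4 : d ((s j)⁻¹ • (s i)⁻¹ • v) v = d v (s i • v) + d v (s j • v) := by
        rw [dist_inv_smul hG, a1]
      have a5 : d ((s j)⁻¹ • (s i)⁻¹ • v) ((s j)⁻¹ • v) = d v (s i • v) := by
        rw [hG, hd.comm, ii]
      have a6 : d (s i • v) (s i • s j • v) = d v (s j • v) := hG _ _ _
      have a7 := hd.concat (a := (s j)⁻¹ • v) (b := v) (c := s i • v) (e := s i • s j • v)
        (by rw [hd.comm _ v, a2, jj]) (by omega) hposi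
      have a8 : d ((s j)⁻¹ • v) v = d v (s j • v) := by rw [hd.comm, jj]
      have a9 := hd.concat (a := (s j)⁻¹ • (s i)⁻¹ • v) (b := (s j)⁻¹ • v) (c := v)
        (e := s i • s j • v) (by omega) (by omega) (by omega)
      refine hyp i j _ v (OnAxis.of_between hd hG ?_ ?_)
      · rw [cij]; intro h; rw [h, hd.self] at a3; omega
      · rw [cij, cij']; omega
  have le : ∀ j, d p (s j • p) ≤ d v (s j • v) := by
    intro j
    rcases claim j with ⟨h1, h2⟩ | ⟨h1, h2⟩
    · rw [h1, h2, hd.self, hd.self]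
    · have := hd.triangle p (s j • v) (s j • p)
      have := hG (s j) v p
      omega
  -- No displacement grows from `v` to `p`, so minimality forces equality throughout. The four-point
  -- condition then leaves only displacement 1 in the second case of `claim`.
  have eq : ∀ j, d p (s j • p) = d v (s j • v) := by
    have := (Finset.sum_eq_sum_iff_of_le (s := Finset.univ) fun j _ => le j).1
      (le_antisymm (Finset.sum_le_sum fun j _ => le j) (hv p))
    exact fun j => this j (Finset.mem_univ j)
  refine ⟨v, p, hp, fun j => ?_⟩
  rcases claim j with h | ⟨h1, h2⟩
  · exact Or.inl h
  · right
    have e1 := hG (s j) v p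
    have e2 : d v (s j • p) = d p ((s j)⁻¹ • v) := by rw [hd.comm p, dist_inv_smul hG]
    have e3 := hd.four_point v (s j • v) p (s j • p)
    have e4 := eq j
    have e5 := hd.comm (s j • v) p
    constructor
    · exact (hd.eq_zero _ _).1 (by omega)
    · exact ((hd.eq_zero _ _).1 (by omega)).symm

/-! ### Interlacing group elements with a hyperbolic element. -/

/-- Coming from `c₀⁻¹ • v₀` through `v₀`, the element `g` may be followed by `c₁`: the geodesic from
`c₀⁻¹ • v₀` to `g • c₁ • v₁` passes through `v₀` and then through `g • v₁`. -/
def Turn {V G : Type*} [Group G] [MulAction G V] (d : V → V → ℕ) (m : ℕ) (c₀ : G) (v₀ : V)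
    (c₁ : G) (v₁ : V) (g : G) : Prop :=
  d (c₀⁻¹ • v₀) (g • c₁ • v₁) = 2 * m + d v₀ (g • v₁)

/-- Both `g` and `g⁻¹` move `v` in the direction of its neighbour `p`. -/
def Reflects {V G : Type*} [Group G] [MulAction G V] (d : V → V → ℕ) (v p : V) (g : G) : Prop :=
  d p (g • v) + 1 = d v (g • v) ∧ d p (g⁻¹ • v) + 1 = d v (g • v)

namespace IsTreeDist

variable {V : Type*} {d : V → V → ℕ} {G : Type*} [Group G] [MulAction G V]

/-- Local geodesics are global: the known geodesic from `z` and the one given by the turn overlap in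
a segment of length `m > 0`, so they concatenate. -/
lemma turn_step (hd : IsTreeDist d) (hG : ∀ (g : G) x y, d (g • x) (g • y) = d x y) {m : ℕ}
    (hm : 0 < m) {c₀ c₁ g h : G} {v₀ v₁ z : V} (h₀ : d v₀ (c₀ • v₀) = m)
    (h₁ : d v₁ (c₁ • v₁) = m) (hz : d z (h • c₀ • v₀) = d z (h • v₀) + m)
    (hg : Turn d m c₀ v₀ c₁ v₁ g) :
    d z ((h * c₀ * g) • c₁ • v₁) = d z ((h * c₀ * g) • v₁) + m ∧
      d z (h • v₀) + m ≤ d z ((h * c₀ * g) • v₁) := by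
  have e1 : d (h • v₀) (h • c₀ • v₀) = m := by rw [hG, h₀]
  have e2 : d (h • v₀) (h • c₀ • g • c₁ • v₁) = 2 * m + d v₀ (g • v₁) := by
    rw [hG, ← dist_inv_smul hG, hg]
  have e3 : d (h • c₀ • v₀) (h • c₀ • g • c₁ • v₁) = d v₀ (g • c₁ • v₁) := by rw [hG, hG]
  have e4 : d (h • c₀ • v₀) (h • c₀ • g • v₁) = d v₀ (g • v₁) := by rw [hG, hG]
  have e5 : d (h • c₀ • g • v₁) (h • c₀ • g • c₁ • v₁) = m := by rw [hG, hG, hG, h₁]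
  have e6 : d (g • v₁) (g • c₁ • v₁) = m := by rw [hG, h₁]
  have t1 := hd.triangle v₀ (g • v₁) (g • c₁ • v₁)
  have t2 := hd.triangle (h • v₀) (h • c₀ • v₀) (h • c₀ • g • c₁ • v₁)
  have t3 := hd.triangle z (h • c₀ • v₀) (h • c₀ • g • v₁)
  have t4 := hd.triangle z (h • c₀ • g • v₁) (h • c₀ • g • c₁ • v₁)
  have := hd.concat (a := z) (b := h • v₀) (c := h • c₀ • v₀) (e := h • c₀ • g • c₁ • v₁)
    (by omega) (by omega) (by omega)
  simp only [mul_smul]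
  omega

lemma turn_of_moves (hd : IsTreeDist d) (hG : ∀ (g : G) x y, d (g • x) (g • y) = d x y) {m : ℕ}
    {c₀ c₁ g : G} {v p q : V} (hg : g • v ≠ v) (h₀ : d v (c₀⁻¹ • v) = m)
    (h₁ : d v (c₁ • v) = m) (hp : d v p = 1) (hpc : d p (c₀⁻¹ • v) + 1 = m)
    (hq : d v q = 1) (hqc : d q (c₁ • v) + 1 = m) (hpg : d p (g • v) + 1 ≠ d v (g • v))
    (hqg : d q (g⁻¹ • v) + 1 ≠ d v (g • v)) : Turn d m c₀ v c₁ v g := by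
  have hpos := hd.pos hg.symm
  have hi := hd.dist_inv_smul_self hG g v
  have e1 := hd.between (a := g • v) (e := c₀⁻¹ • v) hp (by omega) (by omega)
  have e2 := hd.between (a := g⁻¹ • v) (e := c₁ • v) hq (by omega) (by omega)
  have e3 := dist_inv_smul hG g v (c₁ • v)
  have e4 := hG g v (c₁ • v)
  have c1 := hd.comm (g • v) v
  have c2 := hd.comm (g • v) (c₀⁻¹ • v)
  have c3 := hd.comm (g⁻¹ • v) v
  have c4 := hd.comm (c₀⁻¹ • v) v
  have := hd.concat (a := c₀⁻¹ • v) (b := v) (c := g • v) (e := g • c₁ • v)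
    (by omega) (by omega) (by omega)
  unfold Turn
  omega

lemma turn_inv (hd : IsTreeDist d) (hG : ∀ (g : G) x y, d (g • x) (g • y) = d x y) {m : ℕ}
    {c g : G} {v : V} (h : Turn d m c v c v g) : Turn d m c⁻¹ v c⁻¹ v g⁻¹ := by
  unfold Turn at *
  rw [inv_inv, hd.comm, dist_inv_smul hG, h, hd.dist_inv_smul_self hG]

/-- When `g` fixes `v`, backtracking can only occur if `g` carries the direction of `c₁` to that of
`c₀⁻¹`. -/
lemma turn_of_fixes (hd : IsTreeDist d) (hG : ∀ (g : G) x y, d (g • x) (g • y) = d x y) {m : ℕ}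
    {c₀ c₁ g : G} {v p q : V} (hg : g • v = v) (h₀ : d v (c₀⁻¹ • v) = m)
    (h₁ : d v (c₁ • v) = m) (hp : d v p = 1) (hpc : d p (c₀⁻¹ • v) + 1 = m)
    (hq : d v q = 1) (hqc : d q (c₁ • v) + 1 = m) (hpg : g • q ≠ p) :
    Turn d m c₀ v c₁ v g := by
  have e1 := hG g v (c₁ • v)
  have e2 := hG g q (c₁ • v)
  have e3 := hG g v q
  rw [hg] at e1 e3
  unfold Turn
  rw [hg, hd.self]
  have := hd.between (a := g • c₁ • v) (e := c₀⁻¹ • v) hp (fun hcon => hpg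
    (hd.step_unique (y := g • c₁ • v) (by omega) hp (by omega) (by omega))) (by omega)
  rw [hd.comm, this, hd.comm _ v]
  omega

/-- At a vertex of the axis of `c`, every element that does not reflect in the direction of
`c⁻¹` can be used for some turn. -/
lemma turn_or_of_not_reflects (hd : IsTreeDist d)
    (hG : ∀ (g : G) x y, d (g • x) (g • y) = d x y) {m : ℕ} {c : G} {v p q : V}
    (h : OnAxis d c m v) (hp : d v p = 1) (hpc : d p (c • v) + 1 = m) (hq : d v q = 1)
    (hqc : d q (c⁻¹ • v) + 1 = m) {g : G} (hg : ¬ Reflects d v q g) :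
    Turn d m c v c⁻¹ v g ∨ Turn d m c v c v g ∨ Turn d m c⁻¹ v c⁻¹ v g := by
  have hc := h.2.1
  have hc' := (h.inv hd hG).2.1
  have hcc := h.dist_inv_smul hG
  have hm := h.1
  have hpq : p ≠ q := by
    rintro rfl
    have := hd.triangle (c⁻¹ • v) p (c • v)
    have := hd.comm (c⁻¹ • v) p
    omega
  by_cases hgv : g • v = v
  · by_cases hgq : g • q = q
    · right; left
      refine hd.turn_of_fixes hG hgv hc' hc hq hqc hp hpc fun h => hpq ?_
      rw [← hgq] at h
      exact smul_left_cancel g h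
    · exact Or.inl (hd.turn_of_fixes hG hgv hc' hc' hq hqc hq hqc hgq)
  · have hi := hd.dist_inv_smul_self hG g v
    by_cases h1 : d q (g • v) + 1 = d v (g • v)
    · have h2 : d q (g⁻¹ • v) + 1 ≠ d v (g • v) := fun h2 => hg ⟨h1, h2⟩
      right; right
      refine hd.turn_of_moves hG hgv (by rw [inv_inv, hc]) hc' hp (by rw [inv_inv, hpc]) hq hqc
        (fun h3 => hpq (hd.step_unique hp hq h3 h1)) h2
    · by_cases h2 : d q (g⁻¹ • v) + 1 = d v (g • v)
      · right; left
        refine hd.turn_of_moves hG hgv hc' hc hq hqc hp hpc h1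
          (fun h3 => hpq (hd.step_unique hp hq (y := g⁻¹ • v) (by omega) (by omega)))
      · exact Or.inl (hd.turn_of_moves hG hgv hc' hc' hq hqc hq hqc h1 h2)

lemma dist_step_inv (hd : IsTreeDist d) (hG : ∀ (g : G) x y, d (g • x) (g • y) = d x y)
    {m : ℕ} {c : G} {v p : V} (h : OnAxis d c m v) (hp : d v p = 1)
    (hpc : d p (c • v) + 1 = m) : d p (c⁻¹ • v) = m + 1 := by
  have i1 := (h.inv hd hG).2.1
  have b1 := hd.adj_dist hp (c⁻¹ • v)
  have cc := h.dist_inv_smul hG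
  have t1 := hd.triangle (c⁻¹ • v) p (c • v)
  have t2 := hd.comm (c⁻¹ • v) p
  omega

lemma dist_smul_step (hd : IsTreeDist d) (hG : ∀ (g : G) x y, d (g • x) (g • y) = d x y)
    {m : ℕ} {c : G} {v p : V} (h : OnAxis d c m v) (hp : d v p = 1)
    (hpc : d p (c • v) + 1 = m) : d v (c • p) = m + 1 := by
  rw [← dist_inv_smul hG, hd.comm, hd.dist_step_inv hG h hp hpc]

/-- An element inverting an edge of the axis of `c` can be used for turns in both directions. -/
lemma turn_of_inverts (hd : IsTreeDist d) (hG : ∀ (g : G) x y, d (g • x) (g • y) = d x y)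
    {m : ℕ} {c : G} {v p : V} (h : OnAxis d c m v) (hp : d v p = 1)
    (hpc : d p (c • v) + 1 = m) {g : G} (hgv : g • v = p) (hgp : g • p = v) :
    Turn d m c p c⁻¹ v g ∧ Turn d m c⁻¹ v c p g := by
  have h' := h.of_step hd hG hp hpc
  have cp : d p v = 1 := by rw [hd.comm, hp]
  have s1 := hd.dist_step_inv hG h hp hpc
  have s3 := hd.dist_smul_step hG h hp hpc
  have e1 := hG g v (c⁻¹ • v)
  have e2 := hG g p (c⁻¹ • v)
  have e3 := hG g v (c • p)
  have e4 := hG g p (c • p)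
  rw [hgv] at e1 e3
  rw [hgp] at e2 e4
  rw [(h.inv hd hG).2.1] at e1
  rw [h'.2.1] at e4
  rw [s1] at e2
  rw [s3] at e3
  have k1 : d (c⁻¹ • p) p = m := by rw [hd.comm, (h'.inv hd hG).2.1]
  have k2 : d (c⁻¹ • p) v + 1 = m := by rw [dist_inv_smul hG, hpc]
  have k3 : d (c • v) p + 1 = m := by rw [hd.comm, hpc]
  have k4 : d (c • v) v = m := by rw [hd.comm, h.2.1]
  have a1 := hd.concat (a := c⁻¹ • p) (b := v) (c := p) (e := g • c⁻¹ • v)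
    (by rw [hp, k1, k2]) (by rw [hp, e1, e2, add_comm]) (by rw [hp]; exact one_pos)
  have a2 := hd.concat (a := c • v) (b := p) (c := v) (e := g • c • p)
    (by rw [cp, k4, k3]) (by rw [cp, e3, e4, add_comm]) (by rw [cp]; exact one_pos)
  unfold Turn
  rw [inv_inv, hgv, hgp, hd.self, hd.self, a1, a2, e1, e4, hp, cp, k2, k3]
  exact ⟨by ring, by ring⟩

/-- The vertex `t • v` lies between `t • c⁻¹ • v` and `t • c • v`, so the path coming from `z` can
overlap at most one of the two sides. -/
lemma start_or (hd : IsTreeDist d) (hG : ∀ (g : G) x y, d (g • x) (g • y) = d x y)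
    {m : ℕ} {c : G} {v : V} (h : OnAxis d c m v) (t : G) (z : V) :
    d z (t • c • v) = d z (t • v) + m ∨ d z (t • c⁻¹ • v) = d z (t • v) + m := by
  have h1 := hG t (c⁻¹ • v) (c • v)
  have h2 := h.dist_inv_smul hG
  have h3 := hG t v (c • v)
  have h4 := hG t v (c⁻¹ • v)
  have h5 := (h.inv hd hG).2.1
  have h6 := h.2.1
  have := hd.four_point z (t • v) (t • c⁻¹ • v) (t • c • v)
  have := hd.triangle z (t • v) (t • c • v)
  have := hd.triangle z (t • v) (t • c⁻¹ • v)
  omega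

lemma start_or_of_edge (hd : IsTreeDist d) (hG : ∀ (g : G) x y, d (g • x) (g • y) = d x y)
    {m : ℕ} {c : G} {v p : V} (h : OnAxis d c m v) (hp : d v p = 1)
    (hpc : d p (c • v) + 1 = m) (t : G) (z : V) :
    d z (t • c • p) = d z (t • p) + m ∨ d z (t • c⁻¹ • v) = d z (t • v) + m := by
  have h' := h.of_step hd hG hp hpc
  rcases hd.start_or hG h t z with h1 | h1
  · left
    have e1 := hG t v p
    have e2 := hG t p (c • v)
    have e3 := hG t (c • v) (c • p)
    have e4 := hG c v p
    have e5 := hG t p (c • p)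
    have e6 := hG t v (c • p)
    have e7 := hG t v (c • v)
    have hc := h.2.1
    have hc' := h'.2.1
    have hm := h.1
    have cv := hd.dist_smul_step hG h hp hpc
    have t0 := hd.triangle z (t • p) (t • c • v)
    have t1 := hd.triangle z (t • v) (t • p)
    have := hd.concat (a := z) (b := t • v) (c := t • p) (e := t • c • p)
      (by omega) (by omega) (by omega)
    omega
  · exact Or.inr h1

open Classical in
/-- If `v` is not further displaced in total than its neighbour `p`, then at most about half of
the elements reflect in the direction of `p`, except for those that invert the edge. -/
lemma two_mul_card_reflects_le (hd : IsTreeDist d)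
    (hG : ∀ (g : G) x y, d (g • x) (g • y) = d x y) {α : Type*} (U : Finset α) (γ : α → G)
    {v p : V} (hp : d v p = 1)
    (hmin : ∑ u ∈ U, d v (γ u • v) ≤ ∑ u ∈ U, d p (γ u • p)) :
    2 * {u ∈ U | Reflects d v p (γ u)}.card ≤
      U.card + {u ∈ U | γ u • v = p ∧ γ u • p = v}.card := by
  -- From `v` to `p`, the displacement grows by at most 2; it drops by at least 2 for a reflecting
  -- element, unless that element inverts the edge and the displacement stays 1.
  have key : ∀ u ∈ U, d p (γ u • p) + 4 * (if Reflects d v p (γ u) then 1 else 0) ≤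
      d v (γ u • v) + 2 * 1 + 2 * (if γ u • v = p ∧ γ u • p = v then 1 else 0) := by
    intro u _
    set g := γ u
    have e1 := hG g v p
    by_cases hr : Reflects d v p g
    · obtain ⟨h1, h2⟩ := hr
      by_cases hi : g • v = p ∧ g • p = v
      · rw [if_pos ⟨h1, h2⟩, if_pos hi, hi.1, hi.2, hd.comm p v]
      · rw [if_pos ⟨h1, h2⟩, if_neg hi]
        have e2 : d v (g • p) = d p (g⁻¹ • v) := by rw [hd.comm p, dist_inv_smul hG]
        have e3 := hd.four_point v (g • v) p (g • p)
        have e5 := hd.comm (g • v) p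
        have e6 := hd.adj_dist (by omega : d (g • v) (g • p) = 1) p
        have e7 := hd.comm (g • p) p
        by_contra hcon
        exact hi ⟨(hd.eq_zero _ _).1 (by omega), ((hd.eq_zero _ _).1 (by omega)).symm⟩
    · rw [if_neg hr]
      have t1 := hd.triangle p v (g • p)
      have t2 := hd.triangle v (g • v) (g • p)
      have t3 := hd.comm v p
      omega
  have := Finset.sum_le_sum key
  simp only [Finset.sum_add_distrib, ← Finset.mul_sum, Finset.sum_boole, Nat.cast_id,
    Finset.sum_const, smul_eq_mul, mul_one] at this
  omega

open Classical in
/-- Given a hyperbolic element `c` of a group acting on a tree and a finite symmetric family of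
group elements, a positive proportion of this family can be interlaced with `c` and `c⁻¹`
without any backtracking, and after any given element `t`. -/
theorem exists_turns (hd : IsTreeDist d) (hG : ∀ (g : G) x y, d (g • x) (g • y) = d x y)
    {α : Type*} (U : Finset α) (γ : α → G) (ι : α → α) (hιU : ∀ u ∈ U, ι u ∈ U)
    (hι : ∀ u, ι (ι u) = u) (hγ : ∀ u, γ (ι u) = (γ u)⁻¹) {c : G} {m : ℕ}
    (haxis : ∃ v, OnAxis d c m v) (t : G) :
    ∃ (c₀ c₁ : G) (v₀ v₁ z : V), (c₀ = c ∨ c₀ = c⁻¹) ∧ (c₁ = c ∨ c₁ = c⁻¹) ∧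
      d v₀ (c₀ • v₀) = m ∧ d v₁ (c₁ • v₁) = m ∧ d z v₀ ≤ 1 ∧
      d z (t • c₀ • v₀) = d z (t • v₀) + m ∧
      U.card ≤ 16 * {u ∈ U | Turn d m c₀ v₀ c₁ v₁ (γ u)}.card ∧
      U.card ≤ 16 * {u ∈ U | Turn d m c₁ v₁ c₀ v₀ (γ u)}.card := by
  -- Minimality is needed only along the axis, since both neighbours `p` and `q` used for comparison
  -- lie on it.
  obtain ⟨v, hv, hmin⟩ : ∃ v, OnAxis d c m v ∧ ∀ w, OnAxis d c m w →
      ∑ u ∈ U, d v (γ u • v) ≤ ∑ u ∈ U, d w (γ u • w) := by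
    obtain ⟨v, hv, hmin⟩ := (measure fun v : V => ∑ u ∈ U, d v (γ u • v)).wf.has_min
      {v | OnAxis d c m v} haxis
    exact ⟨v, hv, fun w hw => not_lt.1 (hmin w hw)⟩
  have hm := hv.1
  have hv' := hv.inv hd hG
  have hc := hv.2.1
  have hc' := hv'.2.1
  obtain ⟨p, hp, hpc⟩ := hd.step v (c • v) (fun h => by rw [← h, hd.self] at hc; omega)
  obtain ⟨q, hq, hqc⟩ := hd.step v (c⁻¹ • v) (fun h => by rw [← h, hd.self] at hc'; omega)
  rw [hc] at hpc
  rw [hc'] at hqc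
  have hpA := hv.of_step hd hG hp hpc
  have hqA' := hv'.of_step hd hG hq hqc
  have hqA : OnAxis d c m q := by simpa using hqA'.inv hd hG
  have hA := hd.two_mul_card_reflects_le hG U γ hp (hmin p hpA)
  have hB := hd.two_mul_card_reflects_le hG U γ hq (hmin q hqA)
  by_cases hI : U.card ≤ 8 * {u ∈ U | γ u • v = p ∧ γ u • p = v}.card
  · have h1 : {u ∈ U | γ u • v = p ∧ γ u • p = v}.card ≤
        {u ∈ U | Turn d m c p c⁻¹ v (γ u)}.card :=
      Finset.card_le_card (Finset.monotone_filter_right U fun u _ hu =>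
        (hd.turn_of_inverts hG hv hp hpc hu.1 hu.2).1)
    have h2 : {u ∈ U | γ u • v = p ∧ γ u • p = v}.card ≤
        {u ∈ U | Turn d m c⁻¹ v c p (γ u)}.card :=
      Finset.card_le_card (Finset.monotone_filter_right U fun u _ hu =>
        (hd.turn_of_inverts hG hv hp hpc hu.1 hu.2).2)
    rcases hd.start_or_of_edge hG hv hp hpc t v with hs | hs
    · exact ⟨c, c⁻¹, p, v, v, Or.inl rfl, Or.inr rfl, hpA.2.1, hc', hp.le, hs, by omega, by omega⟩
    · exact ⟨c⁻¹, c, v, p, v, Or.inr rfl, Or.inl rfl, hc', hpA.2.1, by simp [hd.self],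
        hs, by omega, by omega⟩
  by_cases hI' : U.card ≤ 8 * {u ∈ U | γ u • v = q ∧ γ u • q = v}.card
  · have h1 : {u ∈ U | γ u • v = q ∧ γ u • q = v}.card ≤
        {u ∈ U | Turn d m c⁻¹ q c v (γ u)}.card :=
      Finset.card_le_card (Finset.monotone_filter_right U fun u _ hu => by
        simpa using (hd.turn_of_inverts hG hv' hq hqc hu.1 hu.2).1)
    have h2 : {u ∈ U | γ u • v = q ∧ γ u • q = v}.card ≤
        {u ∈ U | Turn d m c v c⁻¹ q (γ u)}.card :=
      Finset.card_le_card (Finset.monotone_filter_right U fun u _ hu => by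
        simpa using (hd.turn_of_inverts hG hv' hq hqc hu.1 hu.2).2)
    have hs := hd.start_or_of_edge hG hv' hq hqc t v
    rw [inv_inv] at hs
    rcases hs with hs | hs
    · exact ⟨c⁻¹, c, q, v, v, Or.inr rfl, Or.inl rfl, hqA'.2.1, hc, hq.le, hs, by omega, by omega⟩
    · exact ⟨c, c⁻¹, v, q, v, Or.inl rfl, Or.inr rfl, hc, hqA'.2.1, by simp [hd.self],
        hs, by omega, by omega⟩
  -- With fewer than 1/8 inversions of either edge, at most 9/16 of `U` reflects in either
  -- direction, and the other 7/16 is covered by three kinds of turns. Inversion matches the kinds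
  -- $(c,c)$ and $(c^{-1},c^{-1})$. If these are below 1/16 each, more than 5/16 remains for
  -- $(c,c^{-1})$, and likewise for $(c^{-1},c)$.
  have hsymm : {u ∈ U | Turn d m c v c v (γ u)}.card =
      {u ∈ U | Turn d m c⁻¹ v c⁻¹ v (γ u)}.card := by
    refine Finset.card_bij' (fun u _ => ι u) (fun u _ => ι u) ?_ ?_ (fun u _ => hι u)
      (fun u _ => hι u)
    · intro u hu
      rw [Finset.mem_filter] at hu ⊢
      exact ⟨hιU u hu.1, by rw [hγ]; exact hd.turn_inv hG hu.2⟩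
    · intro u hu
      rw [Finset.mem_filter] at hu ⊢
      exact ⟨hιU u hu.1, by rw [hγ]; simpa using hd.turn_inv hG hu.2⟩
  have cover : ∀ (P Q₁ Q₂ Q₃ : α → Prop), (∀ u, ¬ P u → Q₁ u ∨ Q₂ u ∨ Q₃ u) →
      U.card ≤ (U.filter P).card + (U.filter Q₁).card + (U.filter Q₂).card +
        (U.filter Q₃).card := by
    intro P Q₁ Q₂ Q₃ hPQ
    have hsub : U ⊆ U.filter P ∪ U.filter Q₁ ∪ U.filter Q₂ ∪ U.filter Q₃ := by
      intro u hu
      have := hPQ u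
      simp only [Finset.mem_union, Finset.mem_filter, hu, true_and]
      tauto
    refine (Finset.card_le_card hsub).trans ((Finset.card_union_le _ _).trans ?_)
    refine Nat.add_le_add_right ((Finset.card_union_le _ _).trans ?_) _
    exact Nat.add_le_add_right (Finset.card_union_le _ _) _
  have hcov1 := cover (fun u => Reflects d v q (γ u)) _ _ _
    fun u hu => hd.turn_or_of_not_reflects hG hv hp hpc hq hqc hu
  have hcov2 := cover (fun u => Reflects d v p (γ u)) _ _ _
    fun u hu => hd.turn_or_of_not_reflects hG hv' hq hqc hp (by rw [inv_inv, hpc]) hu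
  simp only [inv_inv] at hcov2
  by_cases hE : U.card ≤ 16 * {u ∈ U | Turn d m c v c v (γ u)}.card
  · rcases hd.start_or hG hv t v with hs | hs
    · exact ⟨c, c, v, v, v, Or.inl rfl, Or.inl rfl, hc, hc, by simp [hd.self],
        hs, hE, hE⟩
    · exact ⟨c⁻¹, c⁻¹, v, v, v, Or.inr rfl, Or.inr rfl, hc', hc', by simp [hd.self],
        hs, by omega, by omega⟩
  · rcases hd.start_or hG hv t v with hs | hs
    · exact ⟨c, c⁻¹, v, v, v, Or.inl rfl, Or.inr rfl, hc, hc', by simp [hd.self],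
        hs, by omega, by omega⟩
    · exact ⟨c⁻¹, c, v, v, v, Or.inr rfl, Or.inl rfl, hc', hc, by simp [hd.self],
        hs, by omega, by omega⟩

end IsTreeDist

/-! ### Reduced words and their number. -/

section Words

open FreeGroup

lemma FreeGroup.IsReduced.invRev {α : Type*} {w : List (α × Bool)} (h : IsReduced w) :
    IsReduced (FreeGroup.invRev w) := by
  classical
  have h1 : (FreeGroup.mk w).toWord = w := by rw [toWord_mk, h.reduce_eq]
  have h2 := isReduced_toWord (x := (FreeGroup.mk w)⁻¹)
  rwa [toWord_inv, h1] at h2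

/-- Any reduced word can be preceded by a given letter `x` after inserting one letter. -/
lemma FreeGroup.IsReduced.exists_cons_cons {n : ℕ} (hn : 2 ≤ n) (x : Fin n × Bool)
    {w : List (Fin n × Bool)} (h : IsReduced w) : ∃ z, IsReduced (x :: z :: w) := by
  have : Nontrivial (Fin n) := Fin.nontrivial_iff_two_le.2 hn
  obtain ⟨k, hk⟩ := exists_ne x.1
  cases w with
  | nil => exact ⟨x, by simp [IsReduced]⟩
  | cons y w =>
    by_cases hy : y.1 = k
    · exact ⟨y, by rw [isReduced_cons_cons, isReduced_cons_cons]; simp [h, hy, hk.symm]⟩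
    · refine ⟨(k, x.2), ?_⟩
      rw [isReduced_cons_cons, isReduced_cons_cons]
      exact ⟨fun _ => rfl, fun h' => absurd h'.symm hy, h⟩

lemma FreeGroup.IsReduced.exists_append {n : ℕ} (hn : 2 ≤ n) (x : Fin n × Bool)
    {w : List (Fin n × Bool)} (h : IsReduced w) :
    ∃ z, IsReduced (w ++ [z, (x.1, !x.2)]) := by
  obtain ⟨z, hz⟩ := h.invRev.exists_cons_cons hn x
  refine ⟨(z.1, !z.2), ?_⟩
  have := hz.invRev
  simpa [FreeGroup.invRev, List.map_reverse, Function.comp_def] using this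

/-- The reduced words of length `L`. -/
noncomputable def reducedLists (n L : ℕ) : Finset (List (Fin n × Bool)) :=
  Set.Finite.toFinset (s := {w | w.length = L ∧ IsReduced w})
    ((List.finite_length_eq (Fin n × Bool) L).subset fun _ h => h.1)

lemma mem_reducedLists {n L : ℕ} {w : List (Fin n × Bool)} :
    w ∈ reducedLists n L ↔ w.length = L ∧ IsReduced w := by
  simp [reducedLists]

lemma card_reducedLists_add (n a b : ℕ) :
    (reducedLists n (a + b)).card ≤ (reducedLists n a).card * (reducedLists n b).card := by
  rw [← Finset.card_product]
  refine Finset.card_le_card_of_injOn (fun w => (w.take a, w.drop a)) ?_ ?_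
  · intro w hw
    have hw' := mem_reducedLists.1 (Finset.mem_coe.1 hw)
    rw [Finset.mem_coe, Finset.mem_product, mem_reducedLists, mem_reducedLists]
    refine ⟨⟨by simp [hw'.1], hw'.2.infix (List.take_prefix a w).isInfix⟩,
      by simp [hw'.1], hw'.2.infix (List.drop_suffix a w).isInfix⟩
  · intro w _ w' _ h
    rw [Prod.mk.injEq] at h
    rw [← List.take_append_drop a w, h.1, h.2, List.take_append_drop]

lemma card_reducedLists_le (n a : ℕ) : (reducedLists n a).card ≤ (2 * n) ^ a := by
  induction a with
  | zero =>
    rw [pow_zero, Finset.card_le_one]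
    intro w hw w' hw'
    rw [List.length_eq_zero_iff.1 (mem_reducedLists.1 hw).1,
      List.length_eq_zero_iff.1 (mem_reducedLists.1 hw').1]
  | succ a ih =>
    have h1 : (reducedLists n 1).card ≤ 2 * n := by
      have : reducedLists n 1 ⊆ Finset.univ.image fun x : Fin n × Bool => [x] := by
        intro w hw
        obtain ⟨x, rfl⟩ := List.length_eq_one_iff.1 (mem_reducedLists.1 hw).1
        simp
      refine (Finset.card_le_card this).trans (Finset.card_image_le.trans ?_)
      simp [mul_comm]
    rw [pow_succ]
    exact (card_reducedLists_add n a 1).trans (Nat.mul_le_mul ih h1)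

lemma card_reducedLists_add_mul (n q b k : ℕ) :
    (reducedLists n (q + b * k)).card ≤
      (reducedLists n q).card * (reducedLists n b).card ^ k := by
  induction k with
  | zero => simp
  | succ k ih =>
    rw [mul_add, mul_one, ← add_assoc, pow_succ, ← mul_assoc]
    exact (card_reducedLists_add n _ b).trans (Nat.mul_le_mul_right _ ih)

open Classical in
/-- The reduced words of length `L` that start with `x` and end with the inverse of `x`. -/
noncomputable def flankedLists (n L : ℕ) (x : Fin n × Bool) : Finset (List (Fin n × Bool)) :=
  {w ∈ reducedLists n L | (∃ w', w = x :: w') ∧ ∃ w', w = w' ++ [(x.1, !x.2)]}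

lemma invRev_mem_flankedLists {n L : ℕ} {x : Fin n × Bool} {w : List (Fin n × Bool)}
    (hw : w ∈ flankedLists n L x) : FreeGroup.invRev w ∈ flankedLists n L x := by
  simp only [flankedLists, Finset.mem_filter, mem_reducedLists] at hw ⊢
  obtain ⟨⟨h1, h2⟩, ⟨w₁, h3⟩, ⟨w₂, h4⟩⟩ := hw
  refine ⟨⟨by rw [invRev_length, h1], h2.invRev⟩, ⟨FreeGroup.invRev w₂, ?_⟩,
    ⟨FreeGroup.invRev w₁, ?_⟩⟩
  · rw [h4, invRev_append]; simp [FreeGroup.invRev]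
  · rw [h3, invRev_cons]; simp [FreeGroup.invRev]

/-- Two letters are added at each end: the prescribed one and a buffer that keeps the word reduced.
The middle recovers the original word. -/
lemma card_reducedLists_le_flankedLists {n : ℕ} (hn : 2 ≤ n) {L : ℕ} (hL : 1 ≤ L)
    (x : Fin n × Bool) : (reducedLists n L).card ≤ (flankedLists n (L + 4) x).card := by
  have key : ∀ w ∈ reducedLists n L, ∃ z z', x :: z :: (w ++ [z', (x.1, !x.2)]) ∈
      flankedLists n (L + 4) x := by
    intro w hw
    obtain ⟨h1, h2⟩ := mem_reducedLists.1 hw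
    obtain ⟨z, hz⟩ := h2.exists_cons_cons hn x
    obtain ⟨z', hz'⟩ := h2.exists_append hn x
    refine ⟨z, z', ?_⟩
    simp only [flankedLists, Finset.mem_filter, mem_reducedLists]
    refine ⟨⟨by simp [h1], ?_⟩, ⟨_, rfl⟩, ⟨x :: z :: (w ++ [z']), by simp⟩⟩
    have hw0 : w ≠ [] := by
      rintro rfl
      simp at h1; omega
    simpa using IsReduced.append_overlap (L₁ := [x, z]) (L₂ := w) (by simpa using hz) hz' hw0
  have : Nonempty (Fin n × Bool) := ⟨x⟩
  choose! z z' hz using key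
  refine Finset.card_le_card_of_injOn _ hz ?_
  intro w hw w' hw' h
  simp only [List.cons.injEq, true_and] at h
  exact (List.append_inj h.2 ((mem_reducedLists.1 hw).1.trans
    (mem_reducedLists.1 hw').1.symm)).1

/-- A concatenation of blocks, each ending in `c`, is reduced if each block may follow `c`. -/
lemma isReduced_append_flatten {α : Type*} {c : List (α × Bool)} (hc : c ≠ [])
    {B : Set (List (α × Bool))} (hB : ∀ b ∈ B, IsReduced (c ++ b) ∧ ∃ b', b = b' ++ c)
    (Bs : List (List (α × Bool))) (hBs : ∀ b ∈ Bs, b ∈ B) :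
    ∀ w : List (α × Bool), IsReduced (w ++ c) → IsReduced (w ++ c ++ Bs.flatten) := by
  induction Bs with
  | nil => intro w hw; simpa using hw
  | cons b Bs ih =>
    intro w hw
    obtain ⟨h1, b', h2⟩ := hB b (hBs b (by simp))
    have := ih (fun b hb => hBs b (by simp [hb])) (w ++ c ++ b') (by
      have := hw.append_overlap h1 hc
      rw [h2] at this
      simpa using this)
    rw [List.flatten_cons, h2]
    simpa using this

/-! ### Languages of words that act nontrivially. -/

namespace IsTreeDist

variable {V : Type*} {d : V → V → ℕ} {n : ℕ} [MulAction (FreeGroup (Fin n)) V]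

lemma dist_append_flatten (hd : IsTreeDist d)
    (hG : ∀ (g : FreeGroup (Fin n)) x y, d (g • x) (g • y) = d x y) {m : ℕ} (hm : 0 < m)
    {c₀ c₁ : List (Fin n × Bool)} {v₀ v₁ z : V} (h₀ : d v₀ (FreeGroup.mk c₀ • v₀) = m)
    (h₁ : d v₁ (FreeGroup.mk c₁ • v₁) = m) (Bs : List (List (Fin n × Bool)))
    (hBs : ∀ b ∈ Bs, ∃ u u', b = u ++ c₁ ++ u' ++ c₀ ∧
      Turn d m (FreeGroup.mk c₀) v₀ (FreeGroup.mk c₁) v₁ (FreeGroup.mk u) ∧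
      Turn d m (FreeGroup.mk c₁) v₁ (FreeGroup.mk c₀) v₀ (FreeGroup.mk u')) :
    ∀ w : List (Fin n × Bool),
      d z (FreeGroup.mk w • FreeGroup.mk c₀ • v₀) = d z (FreeGroup.mk w • v₀) + m →
      d z (FreeGroup.mk w • v₀) + 2 * m * Bs.length + m ≤
        d z (FreeGroup.mk (w ++ c₀ ++ Bs.flatten) • v₀) := by
  induction Bs with
  | nil =>
    intro w hw
    simp [← FreeGroup.mul_mk, mul_smul, hw]
  | cons b Bs ih =>
    intro w hw
    obtain ⟨u, u', rfl, hu, hu'⟩ := hBs _ List.mem_cons_self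
    obtain ⟨h2, h3⟩ := hd.turn_step hG hm h₀ h₁ hw hu
    obtain ⟨h4, h5⟩ := hd.turn_step hG hm h₁ h₀ h2 hu'
    have := ih (fun b hb => hBs b (by simp [hb])) (w ++ c₀ ++ u ++ c₁ ++ u') (by
      simpa only [← FreeGroup.mul_mk] using h4)
    simp only [← FreeGroup.mul_mk, List.flatten_cons, List.length_cons, mul_assoc] at *
    have e : m * (Bs.length + 1) = m * Bs.length + m := by ring
    omega

end IsTreeDist

open Classical in
/-- For an action of a free group on a tree in which the product of two generators is hyperbolic,
there is a large set `B` of words of a fixed length and a prefix `p` of length `r + 2` such that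
all words `p b₁ ⋯ bₖ` with `bᵢ ∈ B` and `k ≥ 1` are reduced and act nontrivially. -/
theorem IsTreeDist.exists_blocks {V : Type*} {d : V → V → ℕ} {n : ℕ}
    [MulAction (FreeGroup (Fin n)) V] (hd : IsTreeDist d)
    (hG : ∀ (g : FreeGroup (Fin n)) x y, d (g • x) (g • y) = d x y) (hn : 2 ≤ n) {i j : Fin n}
    {m : ℕ} (haxis : ∃ v, OnAxis d (of i * of j) m v) {L : ℕ} (hL : 1 ≤ L) (r : ℕ) :
    ∃ (p : List (Fin n × Bool)) (B : Finset (List (Fin n × Bool))), p.length = r + 2 ∧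
      (∀ b ∈ B, b.length = 2 * L + 12) ∧ (reducedLists n L).card ^ 2 ≤ 256 * B.card ∧
      ∀ Bs : List (List (Fin n × Bool)), Bs ≠ [] → (∀ b ∈ Bs, b ∈ B) →
        IsReduced (p ++ Bs.flatten) ∧ ∃ y : V, FreeGroup.mk (p ++ Bs.flatten) • y ≠ y := by
  have : Nontrivial (Fin n) := Fin.nontrivial_iff_two_le.2 hn
  -- The condition `k ≠ i` is enough, even if `k = j`: where $s_k^{\pm1}$ meets $s_j^{\pm1}$, both
  -- exponents have the same sign.
  obtain ⟨k, hk⟩ := exists_ne i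
  set x : Fin n × Bool := (k, true) with hx
  set c : List (Fin n × Bool) := [(i, true), (j, true)] with hc
  have hcm : (FreeGroup.mk c : FreeGroup (Fin n)) = of i * of j := rfl
  have hm : 0 < m := haxis.choose_spec.1
  obtain ⟨g₀, g₁, v₀, v₁, z, hg₀, hg₁, hv₀, hv₁, hz, hstart, hcard₀, hcard₁⟩ :=
    hd.exists_turns hG (flankedLists n (L + 4) x) FreeGroup.mk FreeGroup.invRev
      (fun u hu => invRev_mem_flankedLists hu) (fun u => invRev_invRev) (fun u => inv_mk.symm)
      haxis (FreeGroup.mk (List.replicate r (k, false)))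
  have lift : ∀ g : FreeGroup (Fin n), (g = of i * of j ∨ g = (of i * of j)⁻¹) →
      ∃ c' : List (Fin n × Bool), FreeGroup.mk c' = g ∧ c'.length = 2 ∧ IsReduced (c' ++ [x]) ∧
        IsReduced ((k, false) :: c') := by
    rintro g (rfl | rfl)
    · refine ⟨c, hcm, rfl, ?_, ?_⟩ <;>
        simp [hc, hx, FreeGroup.IsReduced, hk]
    · refine ⟨FreeGroup.invRev c, by rw [← hcm, inv_mk], rfl, ?_, ?_⟩ <;>
        simp [hc, hx, FreeGroup.IsReduced, FreeGroup.invRev, hk.symm]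
  obtain ⟨c₀, rfl, hl₀, hr₀, hr₀'⟩ := lift g₀ hg₀
  obtain ⟨c₁, rfl, hl₁, hr₁, hr₁'⟩ := lift g₁ hg₁
  have hne₀ : c₀ ≠ [] := by rintro rfl; simp at hl₀
  set S₀ := {u ∈ flankedLists n (L + 4) x |
    Turn d m (FreeGroup.mk c₀) v₀ (FreeGroup.mk c₁) v₁ (FreeGroup.mk u)} with hS₀
  set S₁ := {u ∈ flankedLists n (L + 4) x |
    Turn d m (FreeGroup.mk c₁) v₁ (FreeGroup.mk c₀) v₀ (FreeGroup.mk u)} with hS₁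
  have hU := card_reducedLists_le_flankedLists hn hL x
  have flank : ∀ u ∈ flankedLists n (L + 4) x, u.length = L + 4 ∧ IsReduced u ∧
      (∃ w', u = x :: w') ∧ ∃ w', u = w' ++ [(k, false)] := by
    intro u hu
    simp only [flankedLists, Finset.mem_filter, mem_reducedLists] at hu
    exact ⟨hu.1.1, hu.1.2, hu.2⟩
  have hlen₀ : ∀ u ∈ S₀, u.length = L + 4 := fun u hu => (flank u (Finset.mem_filter.1 hu).1).1
  have hlen₁ : ∀ u ∈ S₁, u.length = L + 4 := fun u hu => (flank u (Finset.mem_filter.1 hu).1).1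
  have joinl : ∀ c' : List (Fin n × Bool), IsReduced (c' ++ [x]) →
      ∀ u ∈ flankedLists n (L + 4) x, IsReduced (c' ++ u) := by
    intro c' hc' u hu
    obtain ⟨-, h1, ⟨w', rfl⟩, -⟩ := flank u hu
    simpa using hc'.append_overlap (L₃ := w') (by simpa using h1) (by simp)
  have joinr : ∀ c' : List (Fin n × Bool), IsReduced ((k, false) :: c') →
      ∀ u ∈ flankedLists n (L + 4) x, IsReduced (u ++ c') := by
    intro c' hc' u hu
    obtain ⟨-, h1, -, ⟨w', rfl⟩⟩ := flank u hu
    exact h1.append_overlap (by simpa using hc') (by simp)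
  have hne : ∀ u ∈ flankedLists n (L + 4) x, u ≠ [] := by
    rintro u hu rfl
    have := (flank _ hu).1
    simp at this
  have hne₁ : c₁ ≠ [] := by rintro rfl; simp at hl₁
  -- A block is $u\,c_1 u' c_0$, of length $2(L+4)+4$. Each of $u$ and $u'$ ranges over at least
  -- 1/16 of the flanked words, whence the factor $256 = 16^2$.
  refine ⟨List.replicate r (k, false) ++ c₀,
    (S₀ ×ˢ S₁).image fun u => u.1 ++ c₁ ++ u.2 ++ c₀, by simp [hl₀], ?_, ?_, ?_⟩
  · intro b hb
    obtain ⟨u, hu, rfl⟩ := Finset.mem_image.1 hb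
    rw [Finset.mem_product] at hu
    simp only [List.length_append, hlen₀ _ hu.1, hlen₁ _ hu.2, hl₀, hl₁]
    omega
  · rw [Finset.card_image_of_injOn, Finset.card_product]
    · nlinarith
    · intro u hu u' hu' h
      rw [Finset.mem_coe, Finset.mem_product] at hu hu'
      simp only [List.append_assoc] at h
      obtain ⟨h1, h2⟩ := List.append_inj h ((hlen₀ _ hu.1).trans (hlen₀ _ hu'.1).symm)
      obtain ⟨h3, -⟩ := List.append_inj (List.append_cancel_left h2)
        ((hlen₁ _ hu.2).trans (hlen₁ _ hu'.2).symm)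
      exact Prod.ext h1 h3
  · intro Bs hBs0 hBs
    have hBs' : ∀ b ∈ Bs, ∃ u ∈ S₀, ∃ u' ∈ S₁, b = u ++ c₁ ++ u' ++ c₀ := by
      intro b hb
      obtain ⟨u, hu, rfl⟩ := Finset.mem_image.1 (hBs b hb)
      rw [Finset.mem_product] at hu
      exact ⟨u.1, hu.1, u.2, hu.2, rfl⟩
    constructor
    · refine isReduced_append_flatten hne₀
        (B := {b | ∃ u ∈ S₀, ∃ u' ∈ S₁, b = u ++ c₁ ++ u' ++ c₀}) ?_ Bs hBs' _ ?_
      · rintro b ⟨u, hu, u', hu', rfl⟩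
        have hu := (Finset.mem_filter.1 hu).1
        have hu' := (Finset.mem_filter.1 hu').1
        refine ⟨?_, u ++ c₁ ++ u', rfl⟩
        have h1 := (joinl c₀ hr₀ u hu).append_overlap (joinr c₁ hr₁' u hu) (hne u hu)
        have h2 := h1.append_overlap (joinl c₁ hr₁ u' hu') hne₁
        have h3 := h2.append_overlap (joinr c₀ hr₀' u' hu') (hne u' hu')
        simpa using h3
      · cases r with
        | zero => simpa using hr₀'.infix (List.suffix_cons _ _).isInfix
        | succ r =>
          rw [List.replicate_succ']
          refine IsReduced.append_overlap ?_ (by simpa using hr₀') (by simp)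
          rw [← List.replicate_succ']
          exact List.isChain_replicate_of_rel _ (fun _ => rfl)
    · refine ⟨v₀, fun hfix => ?_⟩
      -- If $v_0$ were fixed, its distance from $z$, at most 1, would have to be at least $3m$.
      have := hd.dist_append_flatten hG hm hv₀ hv₁ Bs (z := z) (fun b hb => by
        obtain ⟨u, hu, u', hu', rfl⟩ := hBs' b hb
        exact ⟨u, u', rfl, (Finset.mem_filter.1 hu).2, (Finset.mem_filter.1 hu').2⟩) _ hstart
      rw [hfix] at this
      have : 0 < Bs.length := List.length_pos_iff.2 hBs0
      nlinarith

/-- If an `n`-generated group does not have property (FA), then it is avoided by many words, in the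
sense that these words represent nontrivial elements. -/
theorem exists_blocks_of_not_hasPropertyFA {n : ℕ} (hn : 2 ≤ n) {G : Type v} [Group G]
    (π : FreeGroup (Fin n) →* G) (hπ : Function.Surjective π) (hFA : ¬ HasPropertyFA.{u} G)
    {L : ℕ} (hL : 1 ≤ L) (r : ℕ) :
    ∃ (p : List (Fin n × Bool)) (B : Finset (List (Fin n × Bool))), p.length = r + 2 ∧
      (∀ b ∈ B, b.length = 2 * L + 12) ∧ (reducedLists n L).card ^ 2 ≤ 256 * B.card ∧
      ∀ Bs : List (List (Fin n × Bool)), Bs ≠ [] → (∀ b ∈ Bs, b ∈ B) →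
        IsReduced (p ++ Bs.flatten) ∧ π (FreeGroup.mk (p ++ Bs.flatten)) ≠ 1 := by
  unfold HasPropertyFA at hFA
  push Not at hFA
  obtain ⟨V, T, hT, ρ, hv, he⟩ := hFA
  let _ : MulAction (FreeGroup (Fin n)) V := MulAction.compHom V (ρ.comp π)
  have smul_def : ∀ (g : FreeGroup (Fin n)) (x : V), g • x = ρ (π g) x := fun _ _ => rfl
  have hd := hT.isTreeDist
  have hG : ∀ (g : FreeGroup (Fin n)) x y, T.dist (g • x) (g • y) = T.dist x y := by
    have le : ∀ (g : FreeGroup (Fin n)) x y, T.dist (g • x) (g • y) ≤ T.dist x y := by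
      intro g x y
      obtain ⟨w, hw⟩ := hT.connected.exists_walk_length_eq_dist x y
      have := SimpleGraph.dist_le (w.map (ρ (π g)).toHom)
      rwa [SimpleGraph.Walk.length_map, hw] at this
    intro g x y
    refine le_antisymm (le g x y) ?_
    simpa using le g⁻¹ (g • x) (g • y)
  have : Nonempty V := hT.connected.nonempty
  rcases hd.exists_onAxis hG (fun i : Fin n => of i) with ⟨v, h⟩ | ⟨v, p, hp, h⟩ | ⟨i, j, m, haxis⟩
  · exfalso
    have : ∀ g : FreeGroup (Fin n), g ∈ MulAction.stabilizer (FreeGroup (Fin n)) v := by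
      have : Subgroup.closure (Set.range (of : Fin n → _)) ≤
          MulAction.stabilizer (FreeGroup (Fin n)) v := by
        rw [Subgroup.closure_le]
        rintro _ ⟨i, rfl⟩
        exact h i
      intro g
      rw [FreeGroup.closure_range_of] at this
      exact this trivial
    obtain ⟨g, hg⟩ := hv v
    obtain ⟨g, rfl⟩ := hπ g
    exact hg (this g)
  · exfalso
    have key : ∀ g : FreeGroup (Fin n), s(g • v, g • p) = s(v, p) := by
      intro g
      induction g using FreeGroup.induction_on with
      | C1 => simp
      | of i => rcases h i with ⟨h1, h2⟩ | ⟨h1, h2⟩ <;> simp [h1, h2, Sym2.eq_swap]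
      | inv_of i _ =>
        rcases h i with ⟨h1, h2⟩ | ⟨h1, h2⟩
        · rw [inv_smul_eq_iff.2 h1.symm, inv_smul_eq_iff.2 h2.symm]
        · rw [inv_smul_eq_iff.2 h1.symm, inv_smul_eq_iff.2 h2.symm, Sym2.eq_swap]
      | mul g g' hg hg' =>
        have := congrArg (Sym2.map (g • ·)) hg'
        simpa [mul_smul, hg] using this
    obtain ⟨g, hg⟩ := he v p (SimpleGraph.dist_eq_one_iff_adj.1 hp)
    obtain ⟨g, rfl⟩ := hπ g
    exact hg (key g)
  · obtain ⟨p, B, h1, h2, h3, h4⟩ := hd.exists_blocks hG hn haxis hL r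
    refine ⟨p, B, h1, h2, h3, fun Bs hBs0 hBs => ⟨(h4 Bs hBs0 hBs).1, fun h => ?_⟩⟩
    obtain ⟨y, hy⟩ := (h4 Bs hBs0 hBs).2
    apply hy
    rw [smul_def, h, _root_.map_one]
    rfl

/-! ### Counting tuples that avoid a language. -/

lemma card_reducedWords (n L : ℕ) :
    Nat.card (reducedWords n L) = (reducedLists n L).card := by
  rw [← Fintype.card_coe, ← Nat.card_eq_fintype_card]
  refine Nat.card_congr
    { toFun := fun w => ⟨w.1.toWord, mem_reducedLists.2 ⟨w.2, isReduced_toWord⟩⟩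
      invFun := fun w => ⟨FreeGroup.mk w.1, ?_⟩
      left_inv := fun w => Subtype.ext mk_toWord
      right_inv := fun w => Subtype.ext ?_ }
  · have h := mem_reducedLists.1 w.2
    simp only [reducedWords, Set.mem_ofPred_eq, toWord_mk, h.2.reduce_eq, h.1]
  · have h := mem_reducedLists.1 w.2
    simp only [toWord_mk, h.2.reduce_eq]

lemma card_reducedLists_pos {n : ℕ} (hn : 2 ≤ n) (L : ℕ) : 0 < (reducedLists n L).card :=
  Finset.card_pos.2 ⟨List.replicate L (⟨0, by omega⟩, true), mem_reducedLists.2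
    ⟨List.length_replicate, List.isChain_replicate_of_rel _ fun _ => rfl⟩⟩

lemma List.flatten_injective_of_length_eq {α : Type*} {b : ℕ} : ∀ (l l' : List (List α)),
    (∀ x ∈ l, x.length = b) → (∀ x ∈ l', x.length = b) → l.length = l'.length →
    l.flatten = l'.flatten → l = l'
  | [], l', _, _, h, _ => (List.length_eq_zero_iff.1 h.symm).symm
  | x :: l, [], _, _, h, _ => by simp at h
  | x :: l, x' :: l', hl, hl', h, hf => by
    rw [List.flatten_cons, List.flatten_cons] at hf
    obtain ⟨h1, h2⟩ := List.append_inj hf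
      ((hl x List.mem_cons_self).trans (hl' x' List.mem_cons_self).symm)
    rw [h1, flatten_injective_of_length_eq l l' (fun y hy => hl y (List.mem_cons_of_mem _ hy))
      (fun y hy => hl' y (List.mem_cons_of_mem _ hy)) (by simpa using h) h2]

open Classical in
/-- If all words `p b₁ ⋯ bₖ` with `bᵢ ∈ B` are reduced, then there are `|B| ^ k` of them. -/
lemma pow_card_le_card_filter {n L b k : ℕ} [Fintype (reducedWords n L)]
    (p : List (Fin n × Bool)) (B : Finset (List (Fin n × Bool))) (hL : L = p.length + b * k)
    (hB : ∀ x ∈ B, x.length = b)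
    (hred : ∀ Bs : List (List (Fin n × Bool)), Bs.length = k → (∀ x ∈ Bs, x ∈ B) →
      IsReduced (p ++ Bs.flatten)) :
    B.card ^ k ≤ (Finset.univ.filter fun w : reducedWords n L =>
      ∃ Bs : List (List (Fin n × Bool)), Bs.length = k ∧ (∀ x ∈ Bs, x ∈ B) ∧
        w.1.toWord = p ++ Bs.flatten).card := by
  have hmem : ∀ f : Fin k → B, ∀ x ∈ List.ofFn fun i => (f i).1, x ∈ B := by
    intro f x hx
    obtain ⟨i, rfl⟩ := (List.mem_ofFn' _ x).1 hx
    exact (f i).2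
  have hword : ∀ f : Fin k → B, (FreeGroup.mk (p ++ (List.ofFn fun i => (f i).1).flatten)).toWord =
      p ++ (List.ofFn fun i => (f i).1).flatten := by
    intro f
    rw [toWord_mk, (hred _ List.length_ofFn (hmem f)).reduce_eq]
  have hlen : ∀ f : Fin k → B,
      FreeGroup.mk (p ++ (List.ofFn fun i => (f i).1).flatten) ∈ reducedWords n L := by
    intro f
    rw [reducedWords, Set.mem_ofPred_eq, hword f, List.length_append, List.length_flatten, hL,
      List.map_congr_left (fun x hx => hB x (hmem f x hx)), List.map_const',
      List.sum_replicate, List.length_ofFn, smul_eq_mul, mul_comm b]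
  have hcard : (Finset.univ : Finset (Fin k → B)).card = B.card ^ k := by
    simp
  rw [← hcard]
  refine Finset.card_le_card_of_injOn (fun f => ⟨_, hlen f⟩) ?_ ?_
  · intro f _
    exact Finset.mem_coe.2 (Finset.mem_filter.2
      ⟨Finset.mem_univ _, _, List.length_ofFn, hmem f, hword f⟩)
  · intro f _ f' _ h
    have h1 := congrArg (fun w : reducedWords n L => w.1.toWord) h
    simp only [hword] at h1
    have h2 := List.flatten_injective_of_length_eq (b := b) _ _ (fun x hx => hB x (hmem f x hx))
      (fun x hx => hB x (hmem f' x hx)) (by simp) (List.append_cancel_left h1)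
    funext i
    exact Subtype.ext (congrFun (List.ofFn_injective h2) i)

/-- The proportion of `N`-tuples avoiding a set of proportion at least `1 / D` is at most
`exp (-N / D)`. -/
lemma card_avoiding_le {Ω : Type*} [Fintype Ω] [DecidableEq Ω] (E : Finset Ω) (N : ℕ) {D : ℝ}
    (hD : 0 < D) (hE : (Fintype.card Ω : ℝ) ≤ D * E.card) :
    ((Fintype.piFinset fun _ : Fin N => Eᶜ).card : ℝ) ≤
      (Fintype.card Ω : ℝ) ^ N * Real.exp (-(N / D)) := by
  have h1 : ((Eᶜ).card : ℝ) ≤ Fintype.card Ω * Real.exp (-(1 / D)) := by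
    have h2 : ((Eᶜ).card : ℝ) = Fintype.card Ω - E.card := by
      rw [Finset.card_compl, Nat.cast_sub (Finset.card_le_univ E)]
    have h3 := Real.add_one_le_exp (-(1 / D))
    have h4 : (Fintype.card Ω : ℝ) / D ≤ E.card := by
      rw [div_le_iff₀ hD, mul_comm]; exact hE
    calc ((Eᶜ).card : ℝ) ≤ Fintype.card Ω * (-(1 / D) + 1) := by
          rw [h2]; ring_nf; rw [div_eq_mul_inv] at h4; linarith
      _ ≤ _ := mul_le_mul_of_nonneg_left h3 (Nat.cast_nonneg _)
  have h5 : Real.exp (-(N / D)) = Real.exp (-(1 / D)) ^ N := by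
    rw [← Real.exp_nat_mul]; congr 1; ring
  rw [Fintype.card_piFinset, Finset.prod_const, Finset.card_univ, Fintype.card_fin, Nat.cast_pow,
    h5, ← mul_pow]
  exact pow_le_pow_left₀ (Nat.cast_nonneg _) h1 N

open Classical in
/-- The number of indices of the family of languages in which relators are sought. -/
noncomputable def languageCount (n b : ℕ) : ℕ :=
  ((List.finite_length_lt (Fin n × Bool) (b + 2)).toFinset ×ˢ
    (List.finite_length_eq (Fin n × Bool) b).toFinset.powerset).card

open Classical in
-- Union bound over the possible pairs of prefix and block set, whose number does not depend on `k`.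
theorem one_sub_le_relatorProb {n : ℕ} (hn : 2 ≤ n) (d : ℝ) {l k r : ℕ} (hl : 1 ≤ l)
    (hk : 1 ≤ k) (hr : r < 2 * l + 12) :
    1 - languageCount n (2 * l + 12) * Real.exp (-(numRelators n d (r + 2 + (2 * l + 12) * k) /
        ((2 * n) ^ (2 * l + 14) * (256 * (2 * n) ^ 12) ^ k))) ≤
      relatorProb n d (r + 2 + (2 * l + 12) * k)
        (fun R => HasPropertyFA.{u} (groupOfRelators R)) := by
  set b := 2 * l + 12 with hb
  set L := r + 2 + b * k with hL
  set N := numRelators n d L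
  -- The first factor bounds the number of prefixes of length `r + 2`; the second accounts for the
  -- loss in each of the `k` blocks.
  set D : ℝ := (2 * n) ^ (2 * l + 14) * (256 * (2 * n) ^ 12) ^ k with hD
  have hDpos : 0 < D := by positivity
  let _ : Fintype (reducedWords n L) := Fintype.ofFinite _
  have hΩ : Fintype.card (reducedWords n L) = (reducedLists n L).card := by
    rw [← Nat.card_eq_fintype_card, card_reducedWords]
  set Idx := (List.finite_length_lt (Fin n × Bool) (b + 2)).toFinset ×ˢ
    (List.finite_length_eq (Fin n × Bool) b).toFinset.powerset with hIdx
  let E : List (Fin n × Bool) × Finset (List (Fin n × Bool)) → Finset (reducedWords n L) :=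
    fun s => Finset.univ.filter fun w : reducedWords n L =>
      ∃ Bs : List (List (Fin n × Bool)), Bs.length = k ∧ (∀ x ∈ Bs, x ∈ s.2) ∧
        w.1.toWord = s.1 ++ Bs.flatten
  -- Only languages of proportion at least `1 / D` matter, because every one arising from a failure
  -- of (FA) is that large.
  set Good := Idx.filter fun s => (Fintype.card (reducedWords n L) : ℝ) ≤ D * (E s).card
  have hcover : (Finset.univ.filter fun R : RelatorTuple n d L =>
      ¬ HasPropertyFA.{u} (groupOfRelators R)) ⊆
      Good.biUnion fun s => Fintype.piFinset fun _ : Fin N => (E s)ᶜ := by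
    intro R hR
    rw [Finset.mem_filter] at hR
    obtain ⟨p, B, h1, h2, h3, h4⟩ := exists_blocks_of_not_hasPropertyFA hn
      (PresentedGroup.mk (Set.range fun i => (R i : FreeGroup (Fin n))))
      (PresentedGroup.mk_surjective _) hR.2 hl r
    have hne : ∀ Bs : List (List (Fin n × Bool)), Bs.length = k → Bs ≠ [] := by
      rintro _ hBs rfl
      simp at hBs; omega
    have hcard := pow_card_le_card_filter (L := L) (b := b) (k := k) p B (by rw [h1]) h2
      fun Bs hBs hBs' => (h4 Bs (hne Bs hBs) hBs').1
    refine Finset.mem_biUnion.2 ⟨(p, B), Finset.mem_filter.2 ⟨?_, ?_⟩, ?_⟩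
    · rw [hIdx, Finset.mem_product, Finset.mem_powerset]
      refine ⟨by simp [h1]; omega, fun x hx => by simp [h2 x hx, hb]⟩
    · have e1 : (reducedLists n L).card ≤
          (2 * n) ^ (2 * l + 14) * (256 * (2 * n) ^ 12) ^ k * B.card ^ k := by
        have a1 := card_reducedLists_add_mul n (r + 2) b k
        have a2 := card_reducedLists_le n (r + 2)
        have a3 : (2 * n) ^ (r + 2) ≤ (2 * n) ^ (2 * l + 14) :=
          Nat.pow_le_pow_right (by omega) (by omega)
        have a4 : (reducedLists n b).card ≤ 256 * (2 * n) ^ 12 * B.card := by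
          calc (reducedLists n b).card = (reducedLists n (l + l + 12)).card := by rw [hb, two_mul]
            _ ≤ (reducedLists n (l + l)).card * (reducedLists n 12).card :=
              card_reducedLists_add n _ _
            _ ≤ ((reducedLists n l).card * (reducedLists n l).card) * (2 * n) ^ 12 :=
              Nat.mul_le_mul (card_reducedLists_add n _ _) (card_reducedLists_le n 12)
            _ ≤ (256 * B.card) * (2 * n) ^ 12 :=
              Nat.mul_le_mul_right _ (by rw [← sq]; exact h3)
            _ = _ := by ring
        calc (reducedLists n L).card ≤ _ := a1
          _ ≤ (2 * n) ^ (2 * l + 14) * (256 * (2 * n) ^ 12 * B.card) ^ k :=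
            Nat.mul_le_mul (a2.trans a3) (Nat.pow_le_pow_left a4 k)
          _ = _ := by rw [mul_pow _ B.card, mul_assoc]
      have e2 := e1.trans (Nat.mul_le_mul_left _ hcard)
      rw [hΩ, hD]
      exact_mod_cast e2
    · rw [Fintype.mem_piFinset]
      intro i
      rw [Finset.mem_compl, Finset.mem_filter]
      rintro ⟨-, Bs, hBs, hBs', hw⟩
      apply (h4 Bs (hne Bs hBs) hBs').2
      rw [← hw, mk_toWord]
      exact PresentedGroup.one_of_mem ⟨i, rfl⟩
  have hbad : ((Finset.univ.filter fun R : RelatorTuple n d L =>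
      ¬ HasPropertyFA.{u} (groupOfRelators R)).card : ℝ) ≤
      languageCount n b * ((Fintype.card (reducedWords n L) : ℝ) ^ N * Real.exp (-(N / D))) := by
    have c1 := (Finset.card_le_card hcover).trans Finset.card_biUnion_le
    have c2 : (∑ s ∈ Good, ((Fintype.piFinset fun _ : Fin N => (E s)ᶜ).card : ℝ)) ≤
        ∑ s ∈ Good, ((Fintype.card (reducedWords n L) : ℝ) ^ N * Real.exp (-(N / D))) :=
      Finset.sum_le_sum fun s hs => card_avoiding_le (E s) N hDpos (Finset.mem_filter.1 hs).2
    rw [Finset.sum_const, nsmul_eq_mul] at c2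
    have c3 : (Good.card : ℝ) ≤ languageCount n b :=
      Nat.cast_le.2 (Finset.card_le_card (Finset.filter_subset _ _))
    calc _ ≤ (∑ s ∈ Good, ((Fintype.piFinset fun _ : Fin N => (E s)ᶜ).card : ℝ)) := by
          exact_mod_cast c1
      _ ≤ _ := c2
      _ ≤ _ := mul_le_mul_of_nonneg_right c3 (by positivity)
  have htot : (Nat.card (RelatorTuple n d L) : ℝ) = (Fintype.card (reducedWords n L) : ℝ) ^ N := by
    rw [Nat.card_eq_fintype_card, Fintype.card_fun, Fintype.card_fin, Nat.cast_pow]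
  have hpos : (0 : ℝ) < (Fintype.card (reducedWords n L) : ℝ) ^ N := by
    have := card_reducedLists_pos hn L
    rw [← hΩ] at this
    positivity
  unfold relatorProb
  rw [htot, le_div_iff₀ hpos, Nat.card_eq_fintype_card,
    Fintype.card_subtype fun R : RelatorTuple n d L => HasPropertyFA.{u} (groupOfRelators R)]
  have hsum := Finset.card_filter_add_card_filter_not (s := (Finset.univ : Finset (RelatorTuple n d L)))
    (fun R => HasPropertyFA.{u} (groupOfRelators R))
  rw [Finset.card_univ, ← Nat.card_eq_fintype_card] at hsum
  have hsum' : ((Finset.univ.filter fun R : RelatorTuple n d L =>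
      HasPropertyFA.{u} (groupOfRelators R)).card : ℝ) +
      ((Finset.univ.filter fun R : RelatorTuple n d L =>
      ¬ HasPropertyFA.{u} (groupOfRelators R)).card : ℝ) =
      (Fintype.card (reducedWords n L) : ℝ) ^ N := by
    rw [← htot]; exact_mod_cast hsum
  linarith

end Words

/-! ### Asymptotics in the length of the relators. -/

open Filter Topology in
lemma tendsto_relatorProb_lower_bound {n : ℕ} (hn : 2 ≤ n) {d : ℝ} (hd : 0 < d) {b : ℕ} (hb : 0 < b)
    {C K M : ℝ} (hC : 0 < C) (hK : 1 ≤ K) (hbK : 2 * K ≤ ((2 * (n : ℝ) - 1) ^ d) ^ b) :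
    Tendsto (fun L : ℕ => 1 - M * Real.exp (-(numRelators n d L / (C * K ^ ((L - 2) / b)))))
      atTop (𝓝 1) := by
  have hn' : (2 : ℝ) ≤ n := by exact_mod_cast hn
  have hbase : (1 : ℝ) ≤ (2 * (n : ℝ) - 1) ^ d := Real.one_le_rpow (by linarith) hd.le
  have hdiv : Tendsto (fun L : ℕ => (L - 2) / b) atTop atTop :=
    (Nat.tendsto_div_const_atTop hb.ne').comp (tendsto_sub_atTop_nat 2)
  have hlow : Tendsto (fun L : ℕ => ((2 : ℝ) ^ ((L - 2) / b) - 1) / C) atTop atTop := by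
    refine Tendsto.atTop_div_const hC (tendsto_atTop_add_const_right _ (-1) ?_)
    exact (tendsto_pow_atTop_atTop_of_one_lt one_lt_two).comp hdiv
  have hmain : Tendsto (fun L : ℕ => (numRelators n d L : ℝ) / (C * K ^ ((L - 2) / b)))
      atTop atTop := by
    refine tendsto_atTop_mono (fun L => ?_) hlow
    set k := (L - 2) / b with hk
    have hKk : (1 : ℝ) ≤ K ^ k := one_le_pow₀ hK
    have h1 : b * k ≤ L := (Nat.mul_div_le (L - 2) b).trans (Nat.sub_le L 2)
    have h2 : (2 : ℝ) ^ k * K ^ k ≤ (2 * (n : ℝ) - 1) ^ (d * (L : ℝ)) := by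
      rw [Real.rpow_mul (by linarith), Real.rpow_natCast, ← mul_pow]
      calc (2 * K) ^ k ≤ (((2 * (n : ℝ) - 1) ^ d) ^ b) ^ k :=
            pow_le_pow_left₀ (by linarith) hbK k
        _ = ((2 * (n : ℝ) - 1) ^ d) ^ (b * k) := (pow_mul _ _ _).symm
        _ ≤ _ := pow_le_pow_right₀ hbase h1
    -- Rounding down costs at most 1, hence at most `K ^ k`, which leaves the ratio `(2 ^ k - 1) /
    -- C`.
    have h3 : (2 : ℝ) ^ k * K ^ k - 1 ≤ numRelators n d L := by
      have := (Nat.lt_floor_add_one ((2 * (n : ℝ) - 1) ^ (d * (L : ℝ)))).le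
      unfold numRelators
      linarith
    rw [div_le_div_iff₀ hC (by positivity)]
    calc ((2 : ℝ) ^ k - 1) * (C * K ^ k) = C * ((2 : ℝ) ^ k * K ^ k - K ^ k) := by ring
      _ ≤ C * numRelators n d L := mul_le_mul_of_nonneg_left (by linarith) hC.le
      _ = _ := mul_comm _ _
  have := ((Real.tendsto_exp_neg_atTop_nhds_zero.comp hmain).const_mul M).const_sub 1
  simpa using this

lemma relatorProb_le_one (n : ℕ) (d : ℝ) (L : ℕ) (P : RelatorTuple n d L → Prop) :
    relatorProb n d L P ≤ 1 := by
  refine div_le_one_of_le₀ ?_ (Nat.cast_nonneg _)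
  exact_mod_cast Finite.card_subtype_le P

theorem mainTheorem1 (n : ℕ) (hn : 2 ≤ n) (d : ℝ) (hd0 : 0 < d) (hd1 : d < 1) :
    WithOverwhelmingProbability n d
      (fun _ R => HasPropertyFA.{u} (groupOfRelators R)) := by
  have hn' : (2 : ℝ) ≤ n := by exact_mod_cast hn
  set K : ℝ := 256 * (2 * n) ^ 12 with hKdef
  have hK : 1 ≤ K := by
    have : (1 : ℝ) ≤ (2 * n) ^ 12 := one_le_pow₀ (by linarith)
    linarith
  have hbase : (1 : ℝ) < (2 * (n : ℝ) - 1) ^ d := Real.one_lt_rpow (by linarith) hd0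
  -- The block length can be chosen after `K`, because `K` does not depend on it.
  obtain ⟨l₀, hl₀⟩ := pow_unbounded_of_one_lt (2 * K) hbase
  set l := l₀ + 1
  set b := 2 * l + 12 with hb
  have hbK : 2 * K ≤ ((2 * (n : ℝ) - 1) ^ d) ^ b :=
    hl₀.le.trans (pow_le_pow_right₀ hbase.le (by omega))
  have hC : (0 : ℝ) < (2 * n) ^ (2 * l + 14) := by positivity
  refine tendsto_of_tendsto_of_tendsto_of_le_of_le'
    (tendsto_relatorProb_lower_bound hn hd0 (b := b) (by omega) (M := languageCount n b) hC hK hbK)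
    tendsto_const_nhds ?_ (Filter.Eventually.of_forall fun L => relatorProb_le_one n d L _)
  filter_upwards [Filter.eventually_ge_atTop (b + 2)] with L hL
  have hk : 1 ≤ (L - 2) / b := (Nat.one_le_div_iff (by omega)).2 (by omega)
  -- The 2 is the length of $c_0$ at the end of the prefix; its remaining letters absorb the residue
  -- of `L - 2` modulo `b`.
  have hLeq : (L - 2) % b + 2 + b * ((L - 2) / b) = L := by
    have := Nat.mod_add_div (L - 2) b
    omega
  have := one_sub_le_relatorProb.{u} hn d (l := l) (by omega) hk
    (Nat.mod_lt (L - 2) (by omega : 0 < b))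
  rwa [← hb, hLeq] at this
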